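/- Let $X$ be a real Banach space with dual $X^*$ and bidual $X^{**}$, and identify an operator $T:X\rightrightarrows X^*$ with its graph $T\subset X\times X^*$. Call $T$ monotone if $\langle x-y,x^*-y^*\rangle\ge 0$ for all $(x,x^*),(y,y^*)\in T$, and maximal monotone if it is maximal with respect to inclusion among monotone subsets of $X\times X^*$; (maximal) monotone subsets of $X^{**}\times X^*$ are defined in the same way. Through the canonical injection $X\subset X^{**}$, regard $T$ as a subset of $X^{**}\times X^*$. Let $\mathcal S_T:X\times X^*\to\overline{\mathbb R}$ be the supremum of all convex lower semicontinuous functions $h:X\times X^*\to\overline{\mathbb R}$ such that $h(x,x^*)\le\langle x,x^*\rangle$ for all $(x,x^*)\in T$, and let $$(\mathcal S_T)^*(x^*,x^{**})=\sup_{(y,y^*)\in X\times X^*}\bigl(\langle y,x^*\rangle+\langle y^*,x^{**}\rangle-\mathcal S_T(y,y^*)\bigr),\qquad (x^*,x^{**})\in X^*\times X^{**}.$$ **Theorem 2.** Suppose that $T:X\rightrightarrows X^*$ is maximal monotone and that $T$ is not affine linear, i.e. $T$ is not of the form $V+\{z_0\}$ with $V$ a linear subspace of $X\times X^*$ and $z_0\in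 X\times X^*$. If $T$ has a unique maximal monotone extension to $X^{**}\times X^*$ (exactly one maximal monotone $\widetilde T\subset X^{**}\times X^*$ satisfies $T\subset\widetilde T$), then $$(\mathcal S_T)^*(x^*,x^{**})\ \ge\ \langle x^*,x^{**}\rangle\qquad\text{for all }(x^*,x^{**})\in X^*\times X^{**},\tag{1}$$ and $T$ has the restricted Brøndsted–Rockafellar property: whenever $0\le\varepsilon<\tilde\varepsilon$ and $(x,x^*)\in X\times X^*$ satisfies $\langle x-y,x^*-y^*\rangle\ge-\varepsilon$ for all $(y,y^*)\in T$, then for every $\lambda>0$ there is $(\bar x,\bar x^*)\in T$ with $\|x-\bar x\|<\lambda$ and $\|\bar x^*-x^*\|<\tilde\varepsilon/\lambda$. Consequently, for a maximal monotone $T$ that is not affine linear, condition (1) holds if and only if $T$ has a unique maximal monotone extension to $X^{**}\times X^*$. -/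

import Mathlib

namespace MonotoneOp

open NormedSpace

noncomputable section

/-! ### Monotone operators -/

/-- A point-to-set operator is identified with its graph `T ⊆ E × F`.  It is monotone with respect
to a bilinear pairing `B` of `E` and `F` if `⟨q - q', r - r'⟩ ≥ 0` for all `(q, r), (q', r') ∈ T`. -/
def IsMonotone {E F : Type*} [AddCommGroup E] [Module ℝ E] [AddCommGroup F] [Module ℝ F]
    (B : E →ₗ[ℝ] F →ₗ[ℝ] ℝ) (T : Set (E × F)) : Prop :=
  ∀ p ∈ T, ∀ q ∈ T, 0 ≤ B (p.1 - q.1) (p.2 - q.2)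

/-- Maximal monotone: monotone, and maximal for inclusion among the monotone subsets of `E × F`. -/
def IsMaximalMonotone {E F : Type*} [AddCommGroup E] [Module ℝ E] [AddCommGroup F] [Module ℝ F]
    (B : E →ₗ[ℝ] F →ₗ[ℝ] ℝ) (T : Set (E × F)) : Prop :=
  Maximal (IsMonotone B) T

/-- A set `A` is affine linear if `A = V + {z₀}` for a linear subspace `V` and a point `z₀`. -/
def IsAffineLinear {Z : Type*} [AddCommGroup Z] [Module ℝ Z] (A : Set Z) : Prop :=
  ∃ (V : Submodule ℝ Z) (z₀ : Z), A = (fun z => z + z₀) '' (V : Set Z)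

/-! ### Extended-real-valued functions -/

/-- Convexity of an extended-real-valued function: its epigraph is convex. -/
def IsConvexFun {Z : Type*} [AddCommGroup Z] [Module ℝ Z] (h : Z → EReal) : Prop :=
  Convex ℝ {p : Z × ℝ | h p.1 ≤ (p.2 : EReal)}

/-- The convex closure of `f`: the supremum of all convex lower semicontinuous functions `h ≤ f`. -/
def clconv {Z : Type*} [AddCommGroup Z] [Module ℝ Z] [TopologicalSpace Z]
    (f : Z → EReal) : Z → EReal :=
  fun z => ⨆ (h : Z → EReal) (_ : IsConvexFun h ∧ LowerSemicontinuous h ∧ h ≤ f), h z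

/-- The Fenchel conjugate `f*(φ) = sup_z (⟨z, φ⟩ - f z)`, a function on the dual space. -/
def conjugate {Z : Type*} [AddCommGroup Z] [Module ℝ Z] [TopologicalSpace Z]
    (f : Z → EReal) : StrongDual ℝ Z → EReal :=
  fun φ => ⨆ z : Z, ((φ z : ℝ) : EReal) - f z

open Classical in
/-- The indicator function of `A`: `0` on `A` and `+∞` elsewhere. -/
def indicatorFun {Z : Type*} (A : Set Z) : Z → EReal :=
  fun z => if z ∈ A then 0 else ⊤

variable {X : Type*} [NormedAddCommGroup X] [NormedSpace ℝ X]

/-! ### Operators from `X` to its dual, and from the bidual to the dual -/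

variable (X) in
/-- The duality product `⟨x, x*⟩ = x*(x)` on `X × X*`. -/
def pairing : X →ₗ[ℝ] StrongDual ℝ X →ₗ[ℝ] ℝ :=
  (topDualPairing ℝ X).flip

variable (X) in
/-- The duality product `⟨x**, x*⟩ = x**(x*)` on `X** × X*`. -/
def bidualPairing : StrongDual ℝ (StrongDual ℝ X) →ₗ[ℝ] StrongDual ℝ X →ₗ[ℝ] ℝ :=
  topDualPairing ℝ (StrongDual ℝ X)

/-- `T ⊆ X × X*` regarded as a subset of `X** × X*` through the canonical injection `X → X**`. -/
def toBidual (T : Set (X × StrongDual ℝ X)) :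
    Set (StrongDual ℝ (StrongDual ℝ X) × StrongDual ℝ X) :=
  (fun p => (inclusionInDoubleDual ℝ X p.1, p.2)) '' T

/-- `T` has exactly one maximal monotone extension to `X** × X*`. -/
def HasUniqueBidualExtension (T : Set (X × StrongDual ℝ X)) : Prop :=
  ∃! S : Set (StrongDual ℝ (StrongDual ℝ X) × StrongDual ℝ X),
    IsMaximalMonotone (bidualPairing X) S ∧ toBidual T ⊆ S

/-- The `S`-function of `T`: the convex closure, on `X × X*` with the norm topology, of the
duality product plus the indicator function of `T`. -/
def SFun (T : Set (X × StrongDual ℝ X)) : X × StrongDual ℝ X → EReal :=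
  clconv fun p => ((pairing X p.1 p.2 : ℝ) : EReal) + indicatorFun T p

/-- The conjugate of the `S`-function as a function of `(x*, x**) ∈ X* × X**`, where `(x*, x**)` is
the functional `(y, y*) ↦ x*(y) + x**(y*)` on `X × X*`. -/
def SFunConj (T : Set (X × StrongDual ℝ X))
    (x' : StrongDual ℝ X) (x'' : StrongDual ℝ (StrongDual ℝ X)) : EReal :=
  conjugate (SFun T) (x'.coprod x'')

/-- The enlargement `T^ε(x) = {x* | ⟨x - y, x* - y*⟩ ≥ -ε for all (y, y*) ∈ T}`. -/
def enlargement (T : Set (X × StrongDual ℝ X)) (ε : ℝ) (x : X) : Set (StrongDual ℝ X) :=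
  {x' | ∀ q ∈ T, -ε ≤ pairing X (x - q.1) (x' - q.2)}

/-- The restricted Brøndsted–Rockafellar property. -/
def RestrictedBR (T : Set (X × StrongDual ℝ X)) : Prop :=
  ∀ (ε ε' : ℝ) (x : X) (x' : StrongDual ℝ X), 0 ≤ ε → ε < ε' → x' ∈ enlargement T ε x →
    ∀ r : ℝ, 0 < r → ∃ p ∈ T, ‖x - p.1‖ < r ∧ ‖p.2 - x'‖ < ε' / r

end

end MonotoneOp

/-!
Write `⟨z, z⟩` for the duality product of the components of `z`. Conjugation does not distinguish a
function from its convex closure, so the conjugate of the `S`-function is the Fitzpatrick function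
of `T` on `X** × X*`, and it majorizes the duality product exactly when
`inf_{w ∈ T} ⟨z - w, z - w⟩ ≤ 0` for all `z ∈ X** × X*` (`isNegInf_iff_le_SFunConj`). Every
monotone extension of `T` to `X** × X*` is contained in the set `polar` of all points monotonically related to `T`.

If the infimum condition holds, the midpoint of two points of `polar` shows that these are related
to each other. So `polar` is monotone, and it is the only maximal monotone extension
(`IsNegInf.existsUnique_maximal`).

Conversely, uniqueness makes `polar` maximal monotone. If the infimum were positive at some `z₀`,
contracting the domain of the Fitzpatrick function towards `z₀` would map any two of its points into
`polar`; the domain would then be monotone and convex, hence equal to `polar`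
(`convex_polar_of_not_isNegInf`). Its trace `T` on `X × X*` would be a convex maximal monotone set,
and such a set is affine (`IsMaximalMonotone.isAffineLinear_of_convex`).

For the restricted Brøndsted–Rockafellar property, a Hahn–Banach separation in `X × X* × ℝ` turns
the infimum condition into the existence, for every `z₀` and `δ > 0`, of a point `z` of the
enlargement `T^δ` with `⟨z - z₀, z - z₀⟩ + s/2 ‖x - x₀‖² + 1/(2s) ‖x* - x₀*‖² < δ`
(`exists_mem_enlargement_pairing_add_energy_lt`). When `z₀ ∈ T^ε`, convexity of the Fitzpatrick
function bounds `⟨z - z₀, z - z₀⟩` from below by about `-ε`, which gives the required bounds on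
`z - z₀`. Iterating the construction with parameters decreasing geometrically yields a limit
point in `T` at distance of order `√δ` from `z` (`exists_mem_dist_le`).
-/

namespace MonotoneOp

open NormedSpace Topology Filter

/-! ### Monotone sets for a bilinear pairing -/

section Bilinear

variable {E F : Type*} [AddCommGroup E] [Module ℝ E] [AddCommGroup F] [Module ℝ F]
  {B : E →ₗ[ℝ] F →ₗ[ℝ] ℝ} {T S : Set (E × F)}

lemma form_convexComb (B : E →ₗ[ℝ] F →ₗ[ℝ] ℝ) (t : ℝ) (z z' w : E × F) :
    B ((t • z + (1 - t) • z').1 - w.1) ((t • z + (1 - t) • z').2 - w.2) =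
      t * B (z.1 - w.1) (z.2 - w.2) + (1 - t) * B (z'.1 - w.1) (z'.2 - w.2) -
        t * (1 - t) * B (z.1 - z'.1) (z.2 - z'.2) := by
  simp only [Prod.fst_add, Prod.snd_add, Prod.smul_fst, Prod.smul_snd, map_sub, map_add, map_smul,
    LinearMap.sub_apply, LinearMap.add_apply, LinearMap.smul_apply, smul_eq_mul]
  ring

lemma form_sub_comm (B : E →ₗ[ℝ] F →ₗ[ℝ] ℝ) (z w : E × F) :
    B (z.1 - w.1) (z.2 - w.2) = B (w.1 - z.1) (w.2 - z.2) := by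
  simp only [map_sub, LinearMap.sub_apply]
  ring

/-- The set of points monotonically related to every point of `T`. -/
def polar (B : E →ₗ[ℝ] F →ₗ[ℝ] ℝ) (T : Set (E × F)) : Set (E × F) :=
  {z | ∀ w ∈ T, 0 ≤ B (z.1 - w.1) (z.2 - w.2)}

/-- `T` is of negative-infimum type: `inf_{w ∈ T} ⟨z - w, z - w⟩ ≤ 0` for every `z`. For the graph
`T ⊆ X** × X*` of an operator on `X` this says that the Fitzpatrick function of `T` on `X** × X*`
majorizes the duality product. -/
def IsNegInf (B : E →ₗ[ℝ] F →ₗ[ℝ] ℝ) (T : Set (E × F)) : Prop :=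
  ∀ z : E × F, ∀ δ : ℝ, 0 < δ → ∃ w ∈ T, B (z.1 - w.1) (z.2 - w.2) < δ

lemma IsMonotone.insert (hT : IsMonotone B T) {z : E × F} (hz : z ∈ polar B T) :
    IsMonotone B (insert z T) := by
  rintro p (rfl | hp) q (rfl | hq)
  · simp
  · exact hz q hq
  · rw [form_sub_comm]
    exact hz p hp
  · exact hT p hp q hq

lemma IsMaximalMonotone.eq_of_subset (hT : IsMaximalMonotone B T) (hS : IsMonotone B S)
    (h : T ⊆ S) : T = S :=
  Maximal.eq_of_subset hT hS h

lemma IsMaximalMonotone.polar_eq (hT : IsMaximalMonotone B T) : polar B T = T := by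
  refine Set.Subset.antisymm (fun z hz => ?_) fun z hz w hw => hT.prop z hz w hw
  rw [hT.eq_of_subset (hT.prop.insert hz) (Set.subset_insert z T)]
  exact Set.mem_insert z T

lemma IsMaximalMonotone.nonempty (hT : IsMaximalMonotone B T) : T.Nonempty := by
  by_contra h
  rw [Set.not_nonempty_iff_eq_empty] at h
  have : (0 : E × F) ∈ polar B T := by
    intro w hw
    simp [h] at hw
  rw [hT.polar_eq, h] at this
  exact this

lemma IsMonotone.exists_maximal (hT : IsMonotone B T) :
    ∃ S, T ⊆ S ∧ IsMaximalMonotone B S := by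
  refine zorn_subset_nonempty {S | IsMonotone B S} (fun c hc hchain _ => ?_) T hT
  refine ⟨⋃₀ c, ?_, fun s hs => Set.subset_sUnion_of_mem hs⟩
  rintro p ⟨s, hs, hp⟩ q ⟨s', hs', hq⟩
  rcases hchain.total hs hs' with h | h
  · exact hc hs' p (h hp) q hq
  · exact hc hs p hp q (h hq)

/-- If exactly one maximal monotone set contains `T`, it consists of all points monotonically
related to `T`, since adding such a point to `T` gives a monotone set. -/
lemma polar_eq_of_existsUnique (hT : IsMonotone B T)
    (hS : IsMaximalMonotone B S) (hTS : T ⊆ S)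
    (huniq : ∀ M, IsMaximalMonotone B M ∧ T ⊆ M → M = S) : polar B T = S := by
  refine Set.Subset.antisymm (fun z hz => ?_) fun z hz w hw => hS.prop z hz w (hTS hw)
  obtain ⟨M, hM, hMmax⟩ := (hT.insert hz).exists_maximal
  rw [← huniq M ⟨hMmax, (Set.subset_insert z T).trans hM⟩]
  exact hM (Set.mem_insert z T)

lemma IsNegInf.polar_isMonotone (h : IsNegInf B T) : IsMonotone B (polar B T) := by
  intro p hp q hq
  by_contra! hlt
  -- The midpoint would be uniformly strictly related to `T`.
  obtain ⟨w, hw, hwlt⟩ := h ((1 / 2 : ℝ) • p + (1 - 1 / 2 : ℝ) • q)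
    (-(B (p.1 - q.1) (p.2 - q.2)) / 4) (by linarith)
  rw [form_convexComb] at hwlt
  linarith [hp w hw, hq w hw]

lemma IsNegInf.existsUnique_maximal (hT : IsMonotone B T) (h : IsNegInf B T) :
    ∃! S, IsMaximalMonotone B S ∧ T ⊆ S := by
  have hsub : ∀ M, IsMonotone B M → T ⊆ M → M ⊆ polar B T :=
    fun M hM hTM z hz w hw => hM z hz w (hTM hw)
  have hTp : T ⊆ polar B T := hsub T hT subset_rfl
  refine ⟨polar B T, ⟨⟨h.polar_isMonotone, fun M hM hpM => hsub M hM (hTp.trans hpM)⟩, hTp⟩, ?_⟩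
  rintro M ⟨hM, hTM⟩
  exact hM.eq_of_subset h.polar_isMonotone (hsub M hM.prop hTM)

/-- A convex maximal monotone set is affine: after a translation to the origin it is stable under
dilations of ratio `≥ 1` by maximality, hence a convex cone, and then symmetric, again by
maximality. -/
lemma IsMaximalMonotone.isAffineLinear_of_convex (hT : IsMaximalMonotone B T)
    (hconv : Convex ℝ T) : IsAffineLinear T := by
  obtain ⟨z₀, hz₀⟩ := hT.nonempty
  have hmem : ∀ z, (∀ w, w + z₀ ∈ T → 0 ≤ B (z.1 - w.1) (z.2 - w.2)) → z + z₀ ∈ T := by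
    intro z hz
    rw [← hT.polar_eq]
    intro w hw
    have := hz (w - z₀) (by simpa using hw)
    simpa [sub_sub_eq_add_sub] using this
  have hmon : ∀ z w, z + z₀ ∈ T → w + z₀ ∈ T → 0 ≤ B (z.1 - w.1) (z.2 - w.2) := by
    intro z w hz hw
    simpa using hT.prop _ hz _ hw
  have hshrink : ∀ t : ℝ, 0 ≤ t → t ≤ 1 → ∀ z, z + z₀ ∈ T → t • z + z₀ ∈ T := by
    intro t h0 h1 z hz
    have := hconv hz hz₀ h0 (sub_nonneg.2 h1) (by ring)
    convert this using 1
    module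
  have hscale : ∀ t : ℝ, 0 ≤ t → ∀ z, z + z₀ ∈ T → t • z + z₀ ∈ T := by
    intro t h0 z hz
    rcases le_total t 1 with h1 | h1
    · exact hshrink t h0 h1 z hz
    · have ht : t ≠ 0 := by positivity
      refine hmem _ fun w hw => ?_
      have := hmon z (t⁻¹ • w) hz (hshrink t⁻¹ (inv_nonneg.2 h0) (inv_le_one_of_one_le₀ h1) w hw)
      have key : B ((t • z).1 - w.1) ((t • z).2 - w.2) =
          t * t * B (z.1 - (t⁻¹ • w).1) (z.2 - (t⁻¹ • w).2) := by
        simp only [Prod.smul_fst, Prod.smul_snd, map_sub, map_smul,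
          LinearMap.sub_apply, LinearMap.smul_apply, smul_eq_mul]
        field_simp
      rw [key]
      positivity
  have hadd : ∀ z w, z + z₀ ∈ T → w + z₀ ∈ T → z + w + z₀ ∈ T := by
    intro z w hz hw
    have := hscale 2 (by norm_num) ((1 / 2 : ℝ) • z + (1 / 2 : ℝ) • w) (by
      have := hconv hz hw (a := 1 / 2) (b := 1 / 2) (by norm_num) (by norm_num) (by norm_num)
      convert this using 1
      module)
    convert this using 1
    module
  have hneg : ∀ z, z + z₀ ∈ T → -z + z₀ ∈ T := by
    intro z hz
    refine hmem _ fun w hw => ?_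
    have h := hmon (z + w) 0 (hadd z w hz hw) (by simpa using hz₀)
    have key : B ((-z).1 - w.1) ((-z).2 - w.2) =
        B ((z + w).1 - (0 : E × F).1) ((z + w).2 - (0 : E × F).2) := by
      simp only [Prod.fst_neg, Prod.snd_neg, Prod.fst_add, Prod.snd_add, Prod.fst_zero,
        Prod.snd_zero, map_sub, map_neg, map_add, map_zero, LinearMap.sub_apply,
        LinearMap.neg_apply, LinearMap.add_apply, LinearMap.zero_apply]
      ring
    rwa [key]
  refine ⟨{ carrier := {z | z + z₀ ∈ T}
            add_mem' := fun {a b} ha hb => hadd a b ha hb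
            zero_mem' := by simpa using hz₀
            smul_mem' := fun t z hz => ?_ }, z₀, ?_⟩
  · rcases le_total 0 t with h | h
    · exact hscale t h z hz
    · have := hscale (-t) (neg_nonneg.2 h) (-z) (hneg z hz)
      simpa using this
  · ext z
    constructor
    · intro hz
      exact ⟨z - z₀, by simpa using hz, by simp⟩
    · rintro ⟨w, hw, rfl⟩
      exact hw

/-- If the set of points related to `T` is maximal monotone but `T` is not of negative-infimum
type, that set is the domain of the Fitzpatrick function of `T`, and hence convex. Contracting the
domain towards a point `z₀` at which the Fitzpatrick function is strictly below the duality product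
moves any two points into `polar B T`, so the domain is itself monotone. -/
lemma convex_polar_of_not_isNegInf (hmax : IsMaximalMonotone B (polar B T))
    (hni : ¬ IsNegInf B T) : Convex ℝ (polar B T) := by
  simp only [IsNegInf, not_forall, not_exists, not_and, not_lt] at hni
  obtain ⟨z₀, δ, hδ, hz₀⟩ := hni
  set D : Set (E × F) := {z | ∃ c : ℝ, ∀ w ∈ T, -c ≤ B (z.1 - w.1) (z.2 - w.2)} with hD
  have hcontract : ∀ z ∈ D, ∃ t₀ : ℝ, 0 < t₀ ∧ ∀ t, 0 ≤ t → t ≤ t₀ →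
      t • z + (1 - t) • z₀ ∈ polar B T := by
    rintro z ⟨c, hc⟩
    set b := B (z.1 - z₀.1) (z.2 - z₀.2) with hb
    refine ⟨δ / (|c| + δ + |b|), by positivity, fun t h0 ht w hw => ?_⟩
    rw [form_convexComb, ← hb]
    rw [le_div_iff₀ (by positivity)] at ht
    have h1 : t * δ ≤ δ := by nlinarith [abs_nonneg c, abs_nonneg b]
    have h2 : t ≤ 1 := by nlinarith
    have e1 : t * -|c| ≤ t * B (z.1 - w.1) (z.2 - w.2) :=
      mul_le_mul_of_nonneg_left (le_trans (neg_le_neg (le_abs_self c)) (hc w hw)) h0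
    have e2 : (1 - t) * δ ≤ (1 - t) * B (z₀.1 - w.1) (z₀.2 - w.2) :=
      mul_le_mul_of_nonneg_left (hz₀ w hw) (by linarith)
    have e3 : t * (1 - t) * b ≤ t * |b| := by
      have : (1 - t) * b ≤ |b| := by
        nlinarith [le_abs_self b, neg_abs_le b, abs_nonneg b]
      nlinarith
    nlinarith
  have hDmono : IsMonotone B D := by
    intro p hp q hq
    obtain ⟨t₁, ht₁, h₁⟩ := hcontract p hp
    obtain ⟨t₂, ht₂, h₂⟩ := hcontract q hq
    set t := min t₁ t₂ with ht
    have htpos : 0 < t := lt_min ht₁ ht₂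
    have h := hmax.prop _ (h₁ t htpos.le (min_le_left _ _)) _ (h₂ t htpos.le (min_le_right _ _))
    have key : B ((t • p + (1 - t) • z₀).1 - (t • q + (1 - t) • z₀).1)
        ((t • p + (1 - t) • z₀).2 - (t • q + (1 - t) • z₀).2) =
        t * t * B (p.1 - q.1) (p.2 - q.2) := by
      simp only [Prod.fst_add, Prod.snd_add, Prod.smul_fst, Prod.smul_snd, map_sub, map_add,
        map_smul, LinearMap.sub_apply, LinearMap.add_apply, LinearMap.smul_apply, smul_eq_mul]
      ring
    rw [key] at h
    exact nonneg_of_mul_nonneg_right h (by positivity)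
  have hDeq : polar B T = D :=
    hmax.eq_of_subset hDmono fun z hz => ⟨0, fun w hw => by simpa using hz w hw⟩
  rw [hDeq]
  rintro p ⟨c, hc⟩ q ⟨d, hd⟩ a b ha hb hab
  obtain rfl : b = 1 - a := by linarith
  refine ⟨a * c + (1 - a) * d + a * (1 - a) * B (p.1 - q.1) (p.2 - q.2), fun w hw => ?_⟩
  rw [form_convexComb]
  nlinarith [mul_le_mul_of_nonneg_left (hc w hw) ha, mul_le_mul_of_nonneg_left (hd w hw) hb]

end Bilinear

/-! ### Extensions to the bidual and the conjugate of the `S`-function -/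

section Bidual

variable {X : Type*} [NormedAddCommGroup X] [NormedSpace ℝ X] {T : Set (X × StrongDual ℝ X)}

lemma pairing_apply' (x : X) (x' : StrongDual ℝ X) : pairing X x x' = x' x := rfl

lemma bidualPairing_apply' (x'' : StrongDual ℝ (StrongDual ℝ X)) (x' : StrongDual ℝ X) :
    bidualPairing X x'' x' = x'' x' := rfl

lemma bidualPairing_sub_inclusion (x'' : StrongDual ℝ (StrongDual ℝ X)) (x' : StrongDual ℝ X)
    (w : X × StrongDual ℝ X) :
    bidualPairing X (x'' - inclusionInDoubleDual ℝ X w.1) (x' - w.2) =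
      x'' x' - (x' w.1 + x'' w.2 - w.2 w.1) := by
  simp only [bidualPairing_apply', map_sub, sub_apply, dual_def]
  ring

lemma bidualPairing_inclusion_sub (z w : X × StrongDual ℝ X) :
    bidualPairing X (inclusionInDoubleDual ℝ X z.1 - inclusionInDoubleDual ℝ X w.1) (z.2 - w.2) =
      pairing X (z.1 - w.1) (z.2 - w.2) := by
  rw [← map_sub]
  rfl

lemma IsMonotone.toBidual (hT : IsMonotone (pairing X) T) :
    IsMonotone (bidualPairing X) (toBidual T) := by
  rintro _ ⟨p, hp, rfl⟩ _ ⟨q, hq, rfl⟩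
  rw [bidualPairing_inclusion_sub]
  exact hT p hp q hq

/-- For a maximal monotone operator that is not affine linear, uniqueness of the extension to the
bidual forces the negative-infimum property. -/
lemma HasUniqueBidualExtension.isNegInf (hT : IsMaximalMonotone (pairing X) T)
    (hna : ¬ IsAffineLinear T) (h : HasUniqueBidualExtension T) :
    IsNegInf (bidualPairing X) (toBidual T) := by
  by_contra hni
  obtain ⟨S, ⟨hS, hTS⟩, huniq⟩ := h
  have hpol := polar_eq_of_existsUnique hT.prop.toBidual hS hTS huniq
  have hconv := convex_polar_of_not_isNegInf (hpol ▸ hS) hni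
  refine hna (hT.isAffineLinear_of_convex ?_)
  have hmem : ∀ z, z ∈ T ↔ (inclusionInDoubleDual ℝ X z.1, z.2) ∈
      polar (bidualPairing X) (MonotoneOp.toBidual T) := by
    intro z
    conv_lhs => rw [← hT.polar_eq]
    constructor
    · rintro hz _ ⟨w, hw, rfl⟩
      rw [bidualPairing_inclusion_sub]
      exact hz w hw
    · intro hz w hw
      rw [← bidualPairing_inclusion_sub]
      exact hz _ ⟨w, hw, rfl⟩
  intro p hp q hq a b ha hb hab
  rw [hmem] at hp hq ⊢
  have := hconv hp hq ha hb hab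
  simpa using this

lemma sub_le_clconv {Z : Type*} [AddCommGroup Z] [Module ℝ Z] [TopologicalSpace Z]
    {f : Z → EReal} (φ : StrongDual ℝ Z) (c : ℝ) (h : ∀ z, ((φ z - c : ℝ) : EReal) ≤ f z) (z : Z) :
    ((φ z - c : ℝ) : EReal) ≤ clconv f z := by
  refine le_iSup₂_of_le (fun z => ((φ z - c : ℝ) : EReal)) ⟨?_, ?_, h⟩ le_rfl
  · intro p hp q hq a b ha hb hab
    simp only [Set.mem_ofPred_eq, EReal.coe_le_coe_iff] at hp hq ⊢
    simp only [Prod.fst_add, Prod.snd_add, Prod.smul_fst, Prod.smul_snd, map_add, map_smul,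
      smul_eq_mul]
    have hc : c = a * c + b * c := by rw [← add_mul, hab, one_mul]
    nlinarith [mul_le_mul_of_nonneg_left hp ha, mul_le_mul_of_nonneg_left hq hb]
  · exact (continuous_coe_real_ereal.comp (φ.continuous.sub continuous_const)).lowerSemicontinuous

lemma clconv_le {Z : Type*} [AddCommGroup Z] [Module ℝ Z] [TopologicalSpace Z]
    (f : Z → EReal) (z : Z) : clconv f z ≤ f z :=
  iSup₂_le fun _ hh => hh.2.2 z

/-- Passing to the convex closure does not change the conjugate, so the conjugate of the
`S`-function is the Fitzpatrick function of `T` on `X** × X*`. -/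
lemma isNegInf_iff_le_SFunConj :
    IsNegInf (bidualPairing X) (toBidual T) ↔
      ∀ (x' : StrongDual ℝ X) (x'' : StrongDual ℝ (StrongDual ℝ X)),
        ((x'' x' : ℝ) : EReal) ≤ SFunConj T x' x'' := by
  constructor
  · intro h x' x''
    refine EReal.ge_of_forall_gt_iff_ge.1 fun r hr => ?_
    have hr' : r < x'' x' := EReal.coe_lt_coe_iff.1 hr
    obtain ⟨_, ⟨w, hw, rfl⟩, hlt⟩ := h (x'', x') (x'' x' - r) (by linarith)
    rw [bidualPairing_sub_inclusion] at hlt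
    refine le_iSup_of_le w ?_
    have hS : SFun T w ≤ ((w.2 w.1 : ℝ) : EReal) := by
      refine (clconv_le _ w).trans ?_
      simp [indicatorFun, hw, pairing_apply']
    refine le_trans ?_ (EReal.sub_le_sub le_rfl hS)
    rw [← EReal.coe_sub, EReal.coe_le_coe_iff]
    simp only [ContinuousLinearMap.coprod_apply]
    linarith
  · intro h
    by_contra hni
    simp only [IsNegInf, not_forall, not_exists, not_and, not_lt] at hni
    obtain ⟨⟨x'', x'⟩, δ, hδ, hz⟩ := hni
    set c : ℝ := x'' x' - δ with hc
    have hle : SFunConj T x' x'' ≤ (c : EReal) := by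
      refine iSup_le fun z => ?_
      have hz : (((x'.coprod x'') z - c : ℝ) : EReal) ≤ SFun T z := by
        refine sub_le_clconv _ c (fun w => ?_) z
        by_cases hw : w ∈ T
        · have := hz _ ⟨w, hw, rfl⟩
          rw [bidualPairing_sub_inclusion] at this
          simp only [indicatorFun, hw, if_true, add_zero, pairing_apply', EReal.coe_le_coe_iff,
            ContinuousLinearMap.coprod_apply]
          linarith
        · simp [indicatorFun, hw]
      refine (EReal.sub_le_sub le_rfl hz).trans ?_
      rw [← EReal.coe_sub, EReal.coe_le_coe_iff]
      linarith
    have := (h x' x'').trans hle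
    rw [EReal.coe_le_coe_iff] at this
    linarith

end Bidual

/-! ### The restricted Brøndsted–Rockafellar property -/

section BrondstedRockafellar

variable {X : Type*} [NormedAddCommGroup X] [NormedSpace ℝ X] {T : Set (X × StrongDual ℝ X)}

/-- The conjugate of `s/2 ‖·‖²` is at least `‖·‖² / (2 s)`. -/
lemma exists_lt_apply_sub_norm_sq (A : StrongDual ℝ X) {s η : ℝ} (hs : 0 < s) (hη : 0 < η) :
    ∃ x : X, ‖A‖ ^ 2 / (2 * s) - η < A x - s / 2 * ‖x‖ ^ 2 := by
  by_contra! h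
  rcases (norm_nonneg A).eq_or_lt with hA | hA
  · have := h 0
    rw [← hA] at this
    simp at this
    linarith
  set c : ℝ := ‖A‖ ^ 2 / (2 * s) - η with hc
  have hc0 : 0 ≤ c := by simpa using h 0
  have hle : ‖A‖ ≤ ‖A‖ / 2 + c * s / ‖A‖ := by
    refine A.opNorm_le_bound (by positivity) fun x => ?_
    rcases eq_or_ne x 0 with rfl | hx
    · simp
    have hx' : 0 < ‖x‖ := norm_pos_iff.2 hx
    have key : ∀ σ : ℝ, σ ^ 2 = 1 → σ * A x ≤ (‖A‖ / 2 + c * s / ‖A‖) * ‖x‖ := by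
      intro σ hσ
      -- `‖A‖ / s` is the norm at which `s / 2 ‖x‖² + c` is to be compared with `A x`.
      have h1 := h ((σ * (‖A‖ / s / ‖x‖)) • x)
      rw [map_smul, norm_smul, mul_pow, Real.norm_eq_abs, sq_abs, mul_pow, hσ, smul_eq_mul] at h1
      have e1 : s / 2 * (1 * (‖A‖ / s / ‖x‖) ^ 2 * ‖x‖ ^ 2) = ‖A‖ ^ 2 / (2 * s) := by
        field_simp
      rw [e1] at h1
      have e2 : σ * A x = (σ * (‖A‖ / s / ‖x‖) * A x) * (s * ‖x‖ / ‖A‖) := by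
        field_simp
      have e3 : (‖A‖ / 2 + c * s / ‖A‖) * ‖x‖ = (‖A‖ ^ 2 / (2 * s) + c) * (s * ‖x‖ / ‖A‖) := by
        field_simp
      rw [e2, e3]
      exact mul_le_mul_of_nonneg_right (by linarith) (by positivity)
    rw [Real.norm_eq_abs]
    refine abs_le'.2 ⟨by simpa using key 1 (by norm_num), by simpa using key (-1) (by norm_num)⟩
  have h2 : ‖A‖ * ‖A‖ ≤ (‖A‖ / 2 + c * s / ‖A‖) * ‖A‖ := mul_le_mul_of_nonneg_right hle hA.le
  have e4 : (‖A‖ / 2 + c * s / ‖A‖) * ‖A‖ = ‖A‖ ^ 2 - s * η := by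
    rw [hc]
    field_simp
    ring
  rw [e4] at h2
  nlinarith [mul_pos hs hη]

lemma norm_sq_convexComb_le {E : Type*} [NormedAddCommGroup E] [NormedSpace ℝ E] (u v : E)
    {a b : ℝ} (ha : 0 ≤ a) (hb : 0 ≤ b) (hab : a + b = 1) :
    ‖a • u + b • v‖ ^ 2 ≤ a * ‖u‖ ^ 2 + b * ‖v‖ ^ 2 := by
  have h : ‖a • u + b • v‖ ≤ a * ‖u‖ + b * ‖v‖ := by
    refine (norm_add_le _ _).trans_eq ?_
    rw [norm_smul, norm_smul, Real.norm_of_nonneg ha, Real.norm_of_nonneg hb]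
  obtain rfl : b = 1 - a := by linarith
  nlinarith [norm_nonneg (a • u + (1 - a) • v), mul_nonneg (mul_nonneg ha hb) (sq_nonneg (‖u‖ - ‖v‖))]

/-- The weighted energy `s/2 ‖x‖² + 1/(2s) ‖x*‖²` on `X × X*`. -/
noncomputable def energy (s : ℝ) (p : X × StrongDual ℝ X) : ℝ :=
  s / 2 * ‖p.1‖ ^ 2 + s⁻¹ / 2 * ‖p.2‖ ^ 2

lemma half_mul_sq_add_half_mul_sq_sub_mul {s : ℝ} (hs : 0 < s) (a b : ℝ) :
    s / 2 * a ^ 2 + s⁻¹ / 2 * b ^ 2 - a * b = (s * a - b) ^ 2 / (2 * s) := by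
  field_simp
  ring

lemma neg_norm_mul_norm_le_pairing (p : X × StrongDual ℝ X) :
    -(‖p.1‖ * ‖p.2‖) ≤ pairing X p.1 p.2 := by
  have := (abs_le.1 (p.2.le_opNorm p.1)).1
  rw [mul_comm]
  exact this

lemma pairing_add_energy_nonneg {s : ℝ} (hs : 0 < s) (p : X × StrongDual ℝ X) :
    0 ≤ pairing X p.1 p.2 + energy s p := by
  have h := neg_norm_mul_norm_le_pairing p
  have h' := half_mul_sq_add_half_mul_sq_sub_mul hs ‖p.1‖ ‖p.2‖
  have : 0 ≤ (s * ‖p.1‖ - ‖p.2‖) ^ 2 / (2 * s) := by positivity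
  rw [energy]
  linarith

lemma IsMaximalMonotone.nonneg_of_mem_enlargement (hT : IsMaximalMonotone (pairing X) T)
    {ε : ℝ} {z : X × StrongDual ℝ X} (hz : z.2 ∈ enlargement T ε z.1) : 0 ≤ ε := by
  by_contra! h
  have hzT : z ∈ T := by
    rw [← hT.polar_eq]
    intro w hw
    linarith [hz w hw]
  have := hz z hzT
  simp at this
  linarith

/-- A Fenchel duality argument, carried out on the convex hull `C` of the graph of the duality
product over `T - z₀`. If `C` did not meet the set `r + energy s p < δ`, then the coefficients of a
separating hyperplane would be a point of `X** × X*` violating the negative-infimum property. -/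
lemma exists_mem_convexHull_add_energy_lt (hne : T.Nonempty)
    (hni : IsNegInf (bidualPairing X) (toBidual T)) (z₀ : X × StrongDual ℝ X) {s δ : ℝ}
    (hs : 0 < s) (hδ : 0 < δ) :
    ∃ q ∈ convexHull ℝ ((fun w : X × StrongDual ℝ X =>
      (w - z₀, pairing X (w.1 - z₀.1) (w.2 - z₀.2))) '' T), q.2 + energy s q.1 < δ := by
  by_contra! hcon
  set C := convexHull ℝ ((fun w : X × StrongDual ℝ X =>
      (w - z₀, pairing X (w.1 - z₀.1) (w.2 - z₀.2))) '' T) with hC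
  set U : Set ((X × StrongDual ℝ X) × ℝ) := {q | q.2 + energy s q.1 < δ} with hU
  have hUopen : IsOpen U := by
    refine isOpen_lt ?_ continuous_const
    unfold energy
    fun_prop
  have hUconv : Convex ℝ U := by
    intro p hp q hq a b ha hb hab
    have hs' : 0 < s⁻¹ := inv_pos.2 hs
    have h1 := mul_le_mul_of_nonneg_left (norm_sq_convexComb_le p.1.1 q.1.1 ha hb hab)
      (half_pos hs).le
    have h2 := mul_le_mul_of_nonneg_left (norm_sq_convexComb_le p.1.2 q.1.2 ha hb hab)
      (half_pos hs').le
    have h3 : a * (p.2 + energy s p.1) + b * (q.2 + energy s q.1) < δ :=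
      (convex_Iio δ) hp hq ha hb hab
    change a * p.2 + b * q.2 + (s / 2 * ‖a • p.1.1 + b • q.1.1‖ ^ 2 +
      s⁻¹ / 2 * ‖a • p.1.2 + b • q.1.2‖ ^ 2) < δ
    simp only [energy] at h3
    linarith
  have hdisj : Disjoint U C := by
    rw [Set.disjoint_left]
    intro q hqU hqC
    exact (hcon q hqC).not_gt hqU
  obtain ⟨f, u, hfU, hfC⟩ := geometric_hahn_banach_open hUconv hUopen (convex_convexHull ℝ _) hdisj
  set c : ℝ := f (0, 1) with hc
  set g : StrongDual ℝ (X × StrongDual ℝ X) := f.comp (.inl ℝ _ _) with hg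
  have hf : ∀ p r, f (p, r) = g p + r * c := by
    intro p r
    have : ((p, r) : (X × StrongDual ℝ X) × ℝ) = (p, 0) + r • (0, 1) := by simp
    rw [this, map_add, map_smul, smul_eq_mul]
    rfl
  have hgen : ∀ w ∈ T, u ≤ g (w - z₀) + pairing X (w.1 - z₀.1) (w.2 - z₀.2) * c := by
    intro w hw
    rw [← hf]
    exact hfC _ (subset_convexHull ℝ _ ⟨w, hw, rfl⟩)
  have hlow : ∀ p r, r + energy s p < δ → g p + r * c < u := by
    intro p r h
    rw [← hf]
    exact hfU (p, r) h
  have hcpos : 0 < c := by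
    by_contra! hc0
    obtain ⟨w, hw⟩ := hne
    have h1 := hgen w hw
    set π := pairing X (w.1 - z₀.1) (w.2 - z₀.2)
    have h2 := hlow (w - z₀) (min π (δ - energy s (w - z₀) - 1)) (by
      linarith [min_le_right π (δ - energy s (w - z₀) - 1)])
    have h3 := mul_le_mul_of_nonpos_right (min_le_left π (δ - energy s (w - z₀) - 1)) hc0
    linarith
  set A : StrongDual ℝ X := c⁻¹ • g.comp (.inl ℝ _ _) with hA
  set A' : StrongDual ℝ (StrongDual ℝ X) := c⁻¹ • g.comp (.inr ℝ _ _) with hA'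
  have hgA : ∀ p, g p = c * (A p.1 + A' p.2) := by
    intro p
    have : p = (p.1, 0) + (0, p.2) := by simp
    conv_lhs => rw [this, map_add]
    have e1 : A p.1 = c⁻¹ * g (p.1, 0) := rfl
    have e2 : A' p.2 = c⁻¹ * g (0, p.2) := rfl
    rw [e1, e2]
    field_simp
  have hup : ∀ p, A p.1 + A' p.2 + δ - energy s p ≤ u / c := by
    intro p
    refine le_of_forall_pos_lt_add fun η hη => ?_
    have := hlow p (δ - energy s p - η) (by linarith)
    rw [hgA] at this
    rw [← sub_lt_iff_lt_add, lt_div_iff₀ hcpos]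
    linarith
  obtain ⟨_, ⟨w, hw, rfl⟩, hlt⟩ := hni (inclusionInDoubleDual ℝ X z₀.1 - A', z₀.2 - A) (δ / 2)
    (half_pos hδ)
  have hw1 : u / c ≤ A (w.1 - z₀.1) + A' (w.2 - z₀.2) +
      pairing X (w.1 - z₀.1) (w.2 - z₀.2) := by
    rw [div_le_iff₀ hcpos]
    have := hgen w hw
    rw [hgA] at this
    simp only [Prod.fst_sub, Prod.snd_sub] at this
    linarith
  have hw2 : A (w.1 - z₀.1) + A' (w.2 - z₀.2) + pairing X (w.1 - z₀.1) (w.2 - z₀.2) + A' A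
      < δ / 2 := by
    refine lt_of_eq_of_lt ?_ hlt
    simp only [bidualPairing_apply', pairing_apply', map_sub, sub_apply,
      LinearMap.sub_apply, dual_def]
    ring
  obtain ⟨x, hx⟩ := exists_lt_apply_sub_norm_sq A hs (half_pos hδ)
  have hx' := hup (x, -A)
  simp only [energy, map_neg, norm_neg] at hx'
  have : s⁻¹ / 2 * ‖A‖ ^ 2 = ‖A‖ ^ 2 / (2 * s) := by field_simp
  linarith

/-- Under the negative-infimum property, for each `z₀ = (x₀, x₀*)` the enlargement `T^δ` contains
approximate solutions `(x, x*)` of `x* - x₀* ∈ -J_s (x - x₀)`, where `J_s` is the subdifferential of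
`s/2 ‖·‖²`. -/
lemma exists_mem_enlargement_pairing_add_energy_lt (hT : IsMaximalMonotone (pairing X) T)
    (hni : IsNegInf (bidualPairing X) (toBidual T)) (z₀ : X × StrongDual ℝ X) {s δ : ℝ}
    (hs : 0 < s) (hδ : 0 < δ) :
    ∃ z : X × StrongDual ℝ X, z.2 ∈ enlargement T δ z.1 ∧
      pairing X (z.1 - z₀.1) (z.2 - z₀.2) + energy s (z - z₀) < δ := by
  obtain ⟨⟨p, r⟩, hpC, hlt⟩ := exists_mem_convexHull_add_energy_lt hT.nonempty hni z₀ hs hδ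
  -- The convex hull lies above the affine minorants that define the Fitzpatrick function.
  have hmin : ∀ w ∈ T, pairing X p.1 (w.2 - z₀.2) + pairing X (w.1 - z₀.1) p.2 -
      pairing X (w.1 - z₀.1) (w.2 - z₀.2) ≤ r := by
    intro w hw
    have hconv : Convex ℝ {q : (X × StrongDual ℝ X) × ℝ | pairing X q.1.1 (w.2 - z₀.2) +
        pairing X (w.1 - z₀.1) q.1.2 - pairing X (w.1 - z₀.1) (w.2 - z₀.2) ≤ q.2} := by
      intro p hp q hq a b ha hb hab
      simp only [Set.mem_ofPred_eq] at hp hq ⊢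
      simp only [Prod.fst_add, Prod.snd_add, Prod.smul_fst, Prod.smul_snd, map_add, map_smul,
        smul_eq_mul, LinearMap.add_apply, LinearMap.smul_apply]
      obtain rfl : b = 1 - a := by linarith
      nlinarith [mul_le_mul_of_nonneg_left hp ha, mul_le_mul_of_nonneg_left hq hb]
    refine convexHull_min ?_ hconv hpC
    rintro _ ⟨v, hv, rfl⟩
    have := hT.prop v hv w hw
    simp only [Set.mem_ofPred_eq, Prod.fst_sub, Prod.snd_sub, pairing_apply', sub_apply,
      LinearMap.sub_apply, map_sub] at this ⊢
    linarith
  have henl : (p + z₀).2 ∈ enlargement T (r - pairing X p.1 p.2) (p + z₀).1 := by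
    intro w hw
    have := hmin w hw
    simp only [Prod.fst_add, Prod.snd_add, pairing_apply', LinearMap.sub_apply,
      LinearMap.add_apply, map_sub, map_add] at this ⊢
    linarith
  have h0 := hT.nonneg_of_mem_enlargement henl
  have h1 := pairing_add_energy_nonneg hs p
  simp only at hlt
  refine ⟨p + z₀, fun w hw => ?_, ?_⟩
  · linarith [henl w hw]
  · simp only [Prod.fst_add, Prod.snd_add, add_sub_cancel_right]
    linarith

/-- Points of the enlargements are almost monotonically related to each other, because a convex
combination of them again lies in an enlargement, whose parameter must be nonnegative. -/
lemma IsMaximalMonotone.neg_le_mul_pairing (hT : IsMaximalMonotone (pairing X) T) {ε δ t : ℝ}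
    {z z' : X × StrongDual ℝ X} (hz : z.2 ∈ enlargement T ε z.1)
    (hz' : z'.2 ∈ enlargement T δ z'.1) (ht : 0 ≤ t) (ht' : t ≤ 1) :
    -(t * ε + (1 - t) * δ) ≤ t * (1 - t) * pairing X (z.1 - z'.1) (z.2 - z'.2) := by
  have h : (t • z + (1 - t) • z').2 ∈ enlargement T (t * ε + (1 - t) * δ +
      t * (1 - t) * pairing X (z.1 - z'.1) (z.2 - z'.2)) (t • z + (1 - t) • z').1 := by
    intro w hw
    rw [form_convexComb]
    have := mul_le_mul_of_nonneg_left (hz w hw) ht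
    have := mul_le_mul_of_nonneg_left (hz' w hw) (sub_nonneg.2 ht')
    linarith
  linarith [hT.nonneg_of_mem_enlargement h]

lemma exists_mem_enlargement_dist_le (hT : IsMaximalMonotone (pairing X) T)
    (hni : IsNegInf (bidualPairing X) (toBidual T)) {d : ℝ} (hd : 0 < d) {z : X × StrongDual ℝ X}
    (hz : z.2 ∈ enlargement T (d ^ 2) z.1) :
    ∃ z' : X × StrongDual ℝ X, z'.2 ∈ enlargement T ((d / 2) ^ 2) z'.1 ∧ dist z z' ≤ 3 * d := by
  obtain ⟨z', hz', hlt⟩ := exists_mem_enlargement_pairing_add_energy_lt hT hni z one_pos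
    (show 0 < (d / 2) ^ 2 by positivity)
  refine ⟨z', hz', ?_⟩
  have h := hT.neg_le_mul_pairing hz' hz (t := 1 / 2) (by norm_num) (by norm_num)
  simp only [energy, inv_one, Prod.fst_sub, Prod.snd_sub] at hlt
  rw [dist_comm, dist_eq_norm]
  refine max_le ?_ ?_
  · refine abs_le_of_sq_le_sq' (a := ‖(z' - z).1‖) ?_ (by positivity) |>.2
    simp only [Prod.fst_sub]
    nlinarith [sq_nonneg ‖z'.2 - z.2‖]
  · refine abs_le_of_sq_le_sq' (a := ‖(z' - z).2‖) ?_ (by positivity) |>.2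
    simp only [Prod.snd_sub]
    nlinarith [sq_nonneg ‖z'.1 - z.1‖]

/-- Every point of the enlargement `T^(d²)` is within distance `6 d` of `T`: the approximation is
iterated with `d`, `d / 2`, `d / 4`, … -/
lemma exists_mem_dist_le [CompleteSpace X] (hT : IsMaximalMonotone (pairing X) T)
    (hni : IsNegInf (bidualPairing X) (toBidual T)) {d : ℝ} (hd : 0 < d) {z : X × StrongDual ℝ X}
    (hz : z.2 ∈ enlargement T (d ^ 2) z.1) : ∃ z' ∈ T, dist z z' ≤ 6 * d := by
  have step : ∀ (n : ℕ) (y : {y : X × StrongDual ℝ X // y.2 ∈ enlargement T ((d / 2 ^ n) ^ 2) y.1}),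
      ∃ y' : {y : X × StrongDual ℝ X // y.2 ∈ enlargement T ((d / 2 ^ (n + 1)) ^ 2) y.1},
        dist y.1 y'.1 ≤ 6 * d / 2 / 2 ^ n := by
    intro n y
    obtain ⟨y', hy', hdist⟩ := exists_mem_enlargement_dist_le hT hni
      (show 0 < d / 2 ^ n by positivity) y.2
    refine ⟨⟨y', ?_⟩, hdist.trans_eq (by ring)⟩
    rwa [pow_succ (2 : ℝ) n, ← div_div]
  choose next hnext using step
  let y : ∀ n, {y : X × StrongDual ℝ X // y.2 ∈ enlargement T ((d / 2 ^ n) ^ 2) y.1} :=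
    fun n => Nat.rec ⟨z, by simpa using hz⟩ next n
  have hy : ∀ n, dist (y n).1 (y (n + 1)).1 ≤ 6 * d / 2 / 2 ^ n := fun n => hnext n (y n)
  obtain ⟨l, hl⟩ := cauchySeq_tendsto_of_complete (cauchySeq_of_le_geometric_two hy)
  refine ⟨l, ?_, dist_le_of_le_geometric_two_of_tendsto₀ hy hl⟩
  rw [← hT.polar_eq]
  intro w hw
  have h1 : Tendsto (fun n => pairing X ((y n).1.1 - w.1) ((y n).1.2 - w.2)) atTop
      (𝓝 (pairing X (l.1 - w.1) (l.2 - w.2))) := by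
    have hcont : Continuous fun p : X × StrongDual ℝ X => pairing X (p.1 - w.1) (p.2 - w.2) := by
      simp only [pairing_apply']
      fun_prop
    exact (hcont.tendsto l).comp hl
  have h2 : Tendsto (fun n : ℕ => -(d / 2 ^ n) ^ 2) atTop (𝓝 0) := by
    have : Tendsto (fun n : ℕ => d / 2 ^ n) atTop (𝓝 0) :=
      tendsto_const_nhds.div_atTop (tendsto_pow_atTop_atTop_of_one_lt one_lt_two)
    simpa using (this.pow 2).neg
  exact le_of_tendsto_of_tendsto' h2 h1 fun n => (y n).2 w hw

/-- If `0 < d < 1`, a point `z ∈ T^(d²)` with `⟨z - z₀, z - z₀⟩ + energy (z - z₀) < d²` is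
close to `z₀ ∈ T^ε`: as `d → 0`, the bound `m + d` below can be made as close to `√ε` as desired. -/
lemma IsMaximalMonotone.norm_sub_le_of_energy_lt (hT : IsMaximalMonotone (pairing X) T)
    {ε σ d m : ℝ} {z z₀ : X × StrongDual ℝ X} (hσ : 0 < σ) (hd : 0 < d) (hd1 : d < 1)
    (hz₀ : z₀.2 ∈ enlargement T ε z₀.1) (hz : z.2 ∈ enlargement T (d ^ 2) z.1)
    (hlt : pairing X (z.1 - z₀.1) (z.2 - z₀.2) + energy (σ ^ 2) (z - z₀) < d ^ 2)
    (hm : 0 ≤ m) (hm2 : d + ε / (1 - d) + d ^ 2 ≤ m ^ 2) :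
    σ * ‖z.1 - z₀.1‖ ≤ m + d ∧ ‖z.2 - z₀.2‖ / σ ≤ m + d := by
  have hpos : 0 < 1 - d := sub_pos.2 hd1
  -- Weight `1 - d` on `z` and `d` on `z₀` balances the parameters `d²` and `ε`.
  have hπ : -(d + ε / (1 - d)) ≤ pairing X (z.1 - z₀.1) (z.2 - z₀.2) := by
    have h := hT.neg_le_mul_pairing hz hz₀ hpos.le (by linarith)
    refine le_of_mul_le_mul_left (h.trans' (le_of_eq ?_)) (mul_pos hpos (sub_pos.2 (by linarith) :
      0 < 1 - (1 - d)))
    field_simp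
    ring
  have hab := neg_norm_mul_norm_le_pairing (z - z₀)
  simp only [energy, Prod.fst_sub, Prod.snd_sub] at hlt hab
  set a := ‖z.1 - z₀.1‖
  set b := ‖z.2 - z₀.2‖
  have ha : 0 ≤ a := norm_nonneg _
  have hb : 0 ≤ b := norm_nonneg _
  have e1 : σ ^ 2 / 2 * a ^ 2 + (σ ^ 2)⁻¹ / 2 * b ^ 2 = ((σ * a) ^ 2 + (b / σ) ^ 2) / 2 := by
    field_simp
  have e2 : a * b = (σ * a) * (b / σ) := by field_simp
  rw [e1] at hlt
  rw [e2] at hab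
  have hA : 0 ≤ σ * a := by positivity
  have hB : 0 ≤ b / σ := by positivity
  generalize σ * a = A at *
  generalize b / σ = B at *
  have hsum : A + B ≤ 2 * m := abs_le_of_sq_le_sq' (by nlinarith [sq_nonneg (A - B)])
    (by positivity) |>.2
  obtain ⟨h1, h2⟩ := abs_le_of_sq_le_sq' (a := A - B) (b := 2 * d) (by nlinarith) (by positivity)
  constructor <;> linarith

lemma IsNegInf.restrictedBR [CompleteSpace X] (hT : IsMaximalMonotone (pairing X) T)
    (hni : IsNegInf (bidualPairing X) (toBidual T)) : RestrictedBR T := by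
  intro ε ε' x x' hε hεε' hx r hr
  have hε' : 0 < ε' := hε.trans_lt hεε'
  -- With this scaling, the bounds `√ε / σ` and `σ √ε` are below `r` and `ε' / r`.
  set σ : ℝ := √ε' / r with hσdef
  have hσ : 0 < σ := by positivity
  set m : ℝ → ℝ := fun d => √(d + ε / (1 - d) + d ^ 2) with hm
  have hmcont : ContinuousAt m 0 := by
    have h1 : ContinuousAt (fun d : ℝ => ε / (1 - d)) 0 :=
      continuousAt_const.div (by fun_prop) (by norm_num)
    exact ((continuousAt_id.add h1).add (by fun_prop)).sqrt
  have hm0 : m 0 = √ε := by simp [hm]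
  have hsqrt : √ε < √ε' := Real.sqrt_lt_sqrt hε hεε'
  have hev₁ : ∀ᶠ d in 𝓝 (0 : ℝ), (m d + d) / σ + 6 * d < r := by
    have hcont : ContinuousAt (fun d => (m d + d) / σ + 6 * d) 0 := by fun_prop
    refine hcont.eventually_lt_const ?_
    simp only [hm0, add_zero, mul_zero]
    rw [div_lt_iff₀ hσ, hσdef, mul_div_cancel₀ _ hr.ne']
    exact hsqrt
  have hev₂ : ∀ᶠ d in 𝓝 (0 : ℝ), (m d + d) * σ + 6 * d < ε' / r := by
    have hcont : ContinuousAt (fun d => (m d + d) * σ + 6 * d) 0 := by fun_prop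
    refine hcont.eventually_lt_const ?_
    simp only [hm0, add_zero, mul_zero]
    rw [hσdef, ← mul_div_assoc]
    refine div_lt_div_of_pos_right ?_ hr
    calc √ε * √ε' < √ε' * √ε' := mul_lt_mul_of_pos_right hsqrt (Real.sqrt_pos.2 hε')
      _ = ε' := Real.mul_self_sqrt hε'.le
  obtain ⟨d, ⟨⟨h₁, h₂⟩, hd1⟩, hd⟩ := ((((hev₁.and hev₂).and
    (eventually_lt_nhds zero_lt_one)).filter_mono nhdsWithin_le_nhds).and
    (self_mem_nhdsWithin : Set.Ioi (0 : ℝ) ∈ 𝓝[>] 0)).exists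
  replace hd : 0 < d := hd
  obtain ⟨z, hz, hlt⟩ := exists_mem_enlargement_pairing_add_energy_lt hT hni (x, x')
    (show 0 < σ ^ 2 by positivity) (show 0 < d ^ 2 by positivity)
  have hnn : 0 ≤ d + ε / (1 - d) + d ^ 2 := by
    have := div_nonneg hε (sub_pos.2 hd1).le
    positivity
  obtain ⟨ha, hb⟩ := hT.norm_sub_le_of_energy_lt (z₀ := (x, x')) hσ hd hd1 hx hz hlt
    (Real.sqrt_nonneg _) (Real.sq_sqrt hnn).ge
  obtain ⟨p, hp, hdist⟩ := exists_mem_dist_le hT hni hd hz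
  have hdist₁ : dist z.1 p.1 ≤ 6 * d := (le_max_left _ _).trans hdist
  have hdist₂ : dist z.2 p.2 ≤ 6 * d := (le_max_right _ _).trans hdist
  refine ⟨p, hp, ?_, ?_⟩
  · rw [mul_comm, ← le_div_iff₀ hσ, ← dist_eq_norm] at ha
    rw [← dist_eq_norm, dist_comm]
    linarith [dist_triangle_left p.1 x z.1]
  · rw [div_le_iff₀ hσ, ← dist_eq_norm] at hb
    rw [← dist_eq_norm]
    linarith [dist_triangle_left p.2 x' z.2]

end BrondstedRockafellar

end MonotoneOp

theorem theorem2 {X : Type*} [NormedAddCommGroup X] [NormedSpace ℝ X] [CompleteSpace X]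
    (T : Set (X × StrongDual ℝ X))
    (hT : MonotoneOp.IsMaximalMonotone (MonotoneOp.pairing X) T)
    (hna : ¬ MonotoneOp.IsAffineLinear T) :
    (MonotoneOp.HasUniqueBidualExtension T →
      (∀ (x' : StrongDual ℝ X) (x'' : StrongDual ℝ (StrongDual ℝ X)),
        ((x'' x' : ℝ) : EReal) ≤ MonotoneOp.SFunConj T x' x'') ∧
      MonotoneOp.RestrictedBR T) ∧
    (MonotoneOp.HasUniqueBidualExtension T ↔
      ∀ (x' : StrongDual ℝ X) (x'' : StrongDual ℝ (StrongDual ℝ X)),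
        ((x'' x' : ℝ) : EReal) ≤ MonotoneOp.SFunConj T x' x'') := by
  rw [← MonotoneOp.isNegInf_iff_le_SFunConj]
  exact ⟨fun h => ⟨h.isNegInf hT hna, (h.isNegInf hT hna).restrictedBR hT⟩,
    fun h => h.isNegInf hT hna, fun h => h.existsUnique_maximal hT.prop.toBidual⟩
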